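/- For non-negative integers $n,r,s$ let $a_n(r,s)=\sum_{k=0}^n\binom nk^r\binom{n+k}k^s$ be the generalised Apéry numbers; in particular $a_n(2,0)=\binom{2n}n$. Write the $3$-adic expansion of a non-negative integer $n$ with its most significant digit first and without leading zeros (the expansion of $0$ is the empty string). Let $d_1$ and $d_2$ be the numbers of digits $1$ and $2$ in it, and let $m$ be the number of its maximal strings of $1$'s (maximal blocks of consecutive digits $1$). A string $xy$ is contained in the expansion if $x$ and $y$ occur in it as consecutive digits in this order; a digit $2$ at the beginning of the expansion also counts as an occurrence of the string $02$. Let $r$ be a positive integer with $r\equiv 2\pmod 6$. Then for every non-negative integer $n$: - (i) $a_n(r,0)\equiv1\pmod 9$ if and only if $d_2=0$, $d_1$ is even, and $m\equiv0\pmod 3$; - (ii) $a_n(r,0)\equiv2\pmod 9$ if and only if $d_2=0$, $d_1$ is odd, and $m\equiv1\pmod 3$; - (iii) $a_n(r,0)\equiv3\pmod 9$ if and only if the expansion of $n$ contains the string $02$ and no other digit $2$ (that is, $d_2=1$), and $d_1$ is odd; - (iv) $a_n(r,0)\equiv4\pmod 9$ if and only if $d_2=0$, $d_1$ is even, and $m\equiv2\pmod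 3$; - (v) $a_n(r,0)\equiv5\pmod 9$ if and only if $d_2=0$, $d_1$ is odd, and $m\equiv2\pmod 3$; - (vi) $a_n(r,0)\equiv6\pmod 9$ if and only if the expansion of $n$ contains the string $02$ and no other digit $2$ (that is, $d_2=1$), and $d_1$ is even; - (vii) $a_n(r,0)\equiv7\pmod 9$ if and only if $d_2=0$, $d_1$ is even, and $m\equiv1\pmod 3$; - (viii) $a_n(r,0)\equiv8\pmod 9$ if and only if $d_2=0$, $d_1$ is odd, and $m\equiv0\pmod 3$; - (ix) $a_n(r,0)\equiv0\pmod 9$ if and only if $d_2\ge2$ or the expansion of $n$ contains the string $12$. -/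

import Mathlib

/-- The generalised Apéry number `a_n(r,s) = ∑_{k=0}^n (n choose k)^r (n+k choose k)^s`. -/
def aperyNumber (n r s : ℕ) : ℕ :=
  ∑ k ∈ Finset.range (n + 1), n.choose k ^ r * (n + k).choose k ^ s

/-- The ternary expansion of `n` as a string of digits, most significant digit first and without
leading zeros (the expansion of `0` is the empty string). -/
def ternaryExpansion (n : ℕ) : List ℕ :=
  (Nat.digits 3 n).reverse

/-- The maximal strings of `a`'s in `w`: the pairs `(i, j)` of positions with `i ≤ j` such that all
letters at the positions `i, ..., j` are `a`, and neither the letter before position `i` nor the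
letter after position `j` (if there is one) is `a`. -/
def maximalStrings (a : ℕ) (w : List ℕ) : Finset (ℕ × ℕ) :=
  {p ∈ Finset.range w.length ×ˢ Finset.range w.length |
    p.1 ≤ p.2 ∧ (∀ t ∈ Finset.Icc p.1 p.2, w[t]? = some a) ∧
      (p.1 = 0 ∨ w[p.1 - 1]? ≠ some a) ∧ w[p.2 + 1]? ≠ some a}

/-- The number of occurrences of the digit `d` in the ternary expansion of `n`. -/
def digitCount (d n : ℕ) : ℕ :=
  (ternaryExpansion n).count d

/-- The number of maximal strings of `1`'s in the ternary expansion of `n`. -/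
def oneStringCount (n : ℕ) : ℕ :=
  (maximalStrings 1 (ternaryExpansion n)).card

/-- The ternary expansion of `n` contains the string `12` (as consecutive digits). -/
def ContainsOneTwo (n : ℕ) : Prop :=
  [1, 2] <:+: ternaryExpansion n

/-- The ternary expansion of `n` contains the string `02` (as consecutive digits), where a `2` at
the beginning of the expansion also counts as an occurrence of `02`. -/
def ContainsZeroTwo (n : ℕ) : Prop :=
  [0, 2] <:+: 0 :: ternaryExpansion n

/-! ### Reduction to the central binomial coefficients -/

/-! Modulo 9 each `x ^ r` equals `x ^ 2`, so everything reduces to c(n) = C(2n, n). Appending a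
ternary digit gives c(3n) = c(n), c(3n+1) = 2(1+3n) c(n), c(3n+2) = 6(2n+1) c(n), with factors
depending only on the last digit of n. A digit 1 contributes -1, and a further 7 (of order 3) when
it opens a block; a 2 after 0 contributes 6, absorbing powers of 7; a 2 after 1, or a second 2,
gives 0. `centralBinom_zmod_nine` runs this induction. The values ±7^j, ±6 and 0 are the nine
distinct residues, whence the equivalences. -/

theorem aperyNumber_two_zero (n : ℕ) : aperyNumber n 2 0 = (2 * n).choose n := by
  simp [aperyNumber, Nat.sum_range_choose_sq]

/-- Units satisfy x^6 = 1, and non-units already have square 0. -/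
theorem ZMod.pow_eq_sq_of_modEq_six {r : ℕ} (h0 : 0 < r) (hr : r ≡ 2 [MOD 6]) (x : ZMod 9) :
    x ^ r = x ^ 2 := by
  obtain ⟨k, rfl⟩ : ∃ k, r = 2 + 6 * k := ⟨r / 6, by have : r % 6 = 2 := hr; omega⟩
  clear h0 hr
  induction k with
  | zero => rfl
  | succ k ih =>
    have h8 : ∀ x : ZMod 9, x ^ 2 * x ^ 6 = x ^ 2 := by decide
    rw [mul_add, mul_one, ← add_assoc, pow_add, ih, h8]

theorem aperyNumber_cast_zmod_nine {r : ℕ} (h0 : 0 < r) (hr : r ≡ 2 [MOD 6]) (n : ℕ) :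
    (aperyNumber n r 0 : ZMod 9) = n.centralBinom := by
  rw [Nat.centralBinom_eq_two_mul_choose, ← aperyNumber_two_zero]
  simp only [aperyNumber, Nat.cast_sum, pow_zero, mul_one, Nat.cast_pow,
    ZMod.pow_eq_sq_of_modEq_six h0 hr]

/-! ### Central binomial coefficients modulo 9 -/

/-- The product of the integers from `1` to `3 * n` that are not divisible by `3`. -/
def prodCoprimeThree (n : ℕ) : ℕ :=
  ∏ k ∈ Finset.range n, (3 * k + 1) * (3 * k + 2)

theorem factorial_three_mul (n : ℕ) :
    (3 * n).factorial = 3 ^ n * n.factorial * prodCoprimeThree n := by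
  induction n with
  | zero => simp [prodCoprimeThree]
  | succ n ih =>
    rw [prodCoprimeThree, Finset.prod_range_succ, ← prodCoprimeThree,
      show 3 * (n + 1) = 3 * n + 1 + 1 + 1 by ring, Nat.factorial_succ, Nat.factorial_succ,
      Nat.factorial_succ, ih, Nat.factorial_succ]
    ring

theorem prodCoprimeThree_cast (n : ℕ) : (prodCoprimeThree n : ZMod 9) = 2 ^ n := by
  have h : ∀ k : ZMod 9, (3 * k + 1) * (3 * k + 2) = 2 := by decide
  simp [prodCoprimeThree, h]

theorem centralBinom_mul_factorial_sq (n : ℕ) :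
    n.centralBinom * (n.factorial * n.factorial) = (2 * n).factorial := by
  have h := Nat.choose_mul_factorial_mul_factorial (show n ≤ 2 * n by omega)
  rwa [show 2 * n - n = n by omega, mul_assoc] at h

/-- Powers of 3 must be cancelled in `ℕ`, before reduction modulo 9. -/
theorem centralBinom_three_mul_mul (n : ℕ) :
    (3 * n).centralBinom * prodCoprimeThree n ^ 2
      = n.centralBinom * prodCoprimeThree (2 * n) := by
  have h1 := centralBinom_mul_factorial_sq (3 * n)
  have h2 := centralBinom_mul_factorial_sq n
  rw [show 2 * (3 * n) = 3 * (2 * n) by ring, factorial_three_mul, factorial_three_mul,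
    ← h2] at h1
  have hpos : 0 < (3 ^ n * n.factorial) ^ 2 := by positivity
  refine Nat.eq_of_mul_eq_mul_left hpos ?_
  calc _ = (3 * n).centralBinom * (3 ^ n * n.factorial * prodCoprimeThree n *
        (3 ^ n * n.factorial * prodCoprimeThree n)) := by ring
    _ = _ := by rw [h1]; ring

theorem centralBinom_three_mul (n : ℕ) :
    ((3 * n).centralBinom : ZMod 9) = n.centralBinom := by
  have h := congrArg (Nat.cast : ℕ → ZMod 9) (centralBinom_three_mul_mul n)
  push_cast [prodCoprimeThree_cast] at h
  rw [← pow_mul, mul_comm n 2] at h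
  have hu : IsUnit ((2 : ZMod 9) ^ (2 * n)) :=
    IsUnit.pow _ (IsUnit.of_mul_eq_one 5 (by decide))
  exact hu.mul_right_cancel h

/-- In (m+1) c(m+1) = 2(2m+1) c(m) with m = 3n, the factor 3n+1 is invertible, and (6n+1)/(3n+1) =
1+3n modulo 9. -/
theorem centralBinom_three_mul_add_one (n : ℕ) :
    ((3 * n + 1).centralBinom : ZMod 9) = 2 * (1 + 3 * n) * n.centralBinom := by
  have h := congrArg (Nat.cast : ℕ → ZMod 9) (Nat.succ_mul_centralBinom_succ (3 * n))
  push_cast at h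
  rw [centralBinom_three_mul] at h
  generalize (n : ZMod 9) = a at *
  generalize (n.centralBinom : ZMod 9) = b at *
  generalize ((3 * n + 1).centralBinom : ZMod 9) = c at *
  revert a b c
  decide +kernel

theorem centralBinom_three_mul_add_two (n : ℕ) :
    ((3 * n + 2).centralBinom : ZMod 9) = 6 * (2 * n + 1) * n.centralBinom := by
  have h := congrArg (Nat.cast : ℕ → ZMod 9) (Nat.succ_mul_centralBinom_succ (3 * n + 1))
  push_cast at h
  rw [centralBinom_three_mul_add_one] at h
  generalize (n : ZMod 9) = a at *
  generalize (n.centralBinom : ZMod 9) = b at *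
  generalize ((3 * n + 2).centralBinom : ZMod 9) = c at *
  revert a b c
  decide +kernel

/-! ### Maximal strings -/

/-- The positions at which a maximal string of `a`'s begins in `w`. -/
def stringStarts (a : ℕ) (w : List ℕ) : Finset ℕ :=
  {i ∈ Finset.range w.length | w[i]? = some a ∧ (i = 0 ∨ w[i - 1]? ≠ some a)}

/-- A maximal string is determined by its start. Being a start depends only on a letter and its
predecessor, so appending a digit leaves old starts intact. -/
theorem card_maximalStrings (a : ℕ) (w : List ℕ) :
    (maximalStrings a w).card = (stringStarts a w).card := by
  refine Finset.card_bij (fun p _ => p.1) ?_ ?_ ?_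
  · rintro ⟨i, j⟩ hp
    simp only [maximalStrings, stringStarts, Finset.mem_filter, Finset.mem_product,
      Finset.mem_range, Finset.mem_Icc] at hp ⊢
    exact ⟨hp.1.1, hp.2.2.1 i ⟨le_rfl, hp.2.1⟩, hp.2.2.2.1⟩
  · rintro ⟨i, j⟩ hp ⟨i', j'⟩ hp' (rfl : i = i')
    simp only [maximalStrings, Finset.mem_filter, Finset.mem_product,
      Finset.mem_range, Finset.mem_Icc] at hp hp'
    rcases lt_trichotomy j j' with h | h | h
    · exact absurd (hp'.2.2.1 (j + 1) ⟨by omega, h⟩) hp.2.2.2.2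
    · rw [h]
    · exact absurd (hp.2.2.1 (j' + 1) ⟨by omega, h⟩) hp'.2.2.2.2
  · intro i hi
    simp only [stringStarts, Finset.mem_filter, Finset.mem_range] at hi
    have hex : ∃ j, i ≤ j ∧ w[j + 1]? ≠ some a :=
      -- Past the end of the list the lookup is `none`.
      ⟨w.length, hi.1.le, by simp⟩
    classical
    obtain ⟨hle, hne⟩ := Nat.find_spec hex
    have hall : ∀ t, i ≤ t → t ≤ Nat.find hex → w[t]? = some a := by
      intro t h1 h2
      rcases h1.eq_or_lt with rfl | h1
      · exact hi.2.1
      · by_contra hcon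
        obtain ⟨s, rfl⟩ : ∃ s, t = s + 1 := ⟨t - 1, by omega⟩
        exact Nat.find_min hex (show s < _ by omega) ⟨by omega, hcon⟩
    have hlt : Nat.find hex < w.length :=
      (List.getElem?_eq_some_iff.mp (hall _ hle le_rfl)).1
    refine ⟨(i, Nat.find hex), ?_, rfl⟩
    simp only [maximalStrings, Finset.mem_filter, Finset.mem_product,
      Finset.mem_range, Finset.mem_Icc]
    exact ⟨⟨hi.1, hlt⟩, hle, fun t ht => hall t ht.1 ht.2, hi.2.2, hne⟩

theorem card_stringStarts_concat (a d : ℕ) (w : List ℕ) :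
    (stringStarts a (w ++ [d])).card
      = (stringStarts a w).card + if d = a ∧ w.getLast? ≠ some a then 1 else 0 := by
  have hold : ∀ i < w.length, (w ++ [d])[i]? = w[i]? := fun i hi =>
    List.getElem?_append_left hi
  have hfilter : {i ∈ Finset.range w.length | (w ++ [d])[i]? = some a ∧
      (i = 0 ∨ (w ++ [d])[i - 1]? ≠ some a)} = stringStarts a w := by
    refine Finset.filter_congr fun i hi => ?_
    have hi' := Finset.mem_range.mp hi
    rw [hold i hi', hold (i - 1) (by omega)]
  have hnew : ((w ++ [d])[w.length]? = some a ∧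
      (w.length = 0 ∨ (w ++ [d])[w.length - 1]? ≠ some a)) ↔
      (d = a ∧ w.getLast? ≠ some a) := by
    rcases eq_or_ne w [] with rfl | hw
    · simp
    · have hpos : 0 < w.length := List.length_pos_iff.mpr hw
      rw [hold (w.length - 1) (by omega), List.getLast?_eq_getElem?]
      simp [hw]
  rw [stringStarts, List.length_append, List.length_singleton, Finset.range_add_one,
    Finset.filter_insert, hfilter]
  by_cases h : d = a ∧ w.getLast? ≠ some a
  · rw [if_pos (hnew.mpr h), if_pos h, Finset.card_insert_of_notMem]
    simp [stringStarts]
  · rw [if_neg (mt hnew.mp h), if_neg h, add_zero]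

/-! ### Appending a digit to a ternary expansion -/

/-- The side condition excludes 0 = 3 * 0 + 0, whose expansion is empty. -/
theorem ternaryExpansion_three_mul_add {n d : ℕ} (hd : d < 3) (h : d ≠ 0 ∨ n ≠ 0) :
    ternaryExpansion (3 * n + d) = ternaryExpansion n ++ [d] := by
  rw [ternaryExpansion, add_comm, Nat.digits_add 3 (by norm_num) d n hd h, List.reverse_cons,
    ternaryExpansion]

theorem getLast?_ternaryExpansion {n : ℕ} (h : n ≠ 0) :
    (ternaryExpansion n).getLast? = some (n % 3) := by
  have := ternaryExpansion_three_mul_add (n := n / 3) (d := n % 3) (Nat.mod_lt _ (by norm_num))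
    (by omega)
  rw [Nat.div_add_mod] at this
  simp [this]

theorem digitCount_three_mul_add (a : ℕ) {n d : ℕ} (hd : d < 3) (h : d ≠ 0 ∨ n ≠ 0) :
    digitCount a (3 * n + d) = digitCount a n + if d = a then 1 else 0 := by
  simp [digitCount, ternaryExpansion_three_mul_add hd h, List.count_singleton]

theorem oneStringCount_three_mul_add {n d : ℕ} (hd : d < 3) (h : d ≠ 0 ∨ n ≠ 0) :
    oneStringCount (3 * n + d) = oneStringCount n + if d = 1 ∧ n % 3 ≠ 1 then 1 else 0 := by
  rw [oneStringCount, card_maximalStrings, ternaryExpansion_three_mul_add hd h,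
    card_stringStarts_concat, ← card_maximalStrings, oneStringCount]
  rcases eq_or_ne n 0 with rfl | hn
  · simp [ternaryExpansion]
  · simp [getLast?_ternaryExpansion hn]

theorem pair_infix_concat_iff {a b d : ℕ} {w : List ℕ} :
    [a, b] <:+: w ++ [d] ↔ [a, b] <:+: w ∨ (d = b ∧ w.getLast? = some a) := by
  rw [List.infix_concat_iff, or_comm]
  refine or_congr_right ?_
  rw [List.suffix_concat_iff]
  constructor
  · rintro (h | ⟨t, ht, u, rfl⟩)
    · simp at h
    · obtain ⟨rfl, hd⟩ := List.append_inj' (show [a] ++ [b] = t ++ [d] from ht) rfl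
      simp_all
  · rintro ⟨rfl, h⟩
    obtain ⟨u, rfl⟩ := List.getLast?_eq_some_iff.mp h
    exact Or.inr ⟨[a], rfl, u, rfl⟩

theorem containsOneTwo_three_mul_add {n d : ℕ} (hd : d < 3) (h : d ≠ 0 ∨ n ≠ 0) :
    ContainsOneTwo (3 * n + d) ↔ ContainsOneTwo n ∨ (d = 2 ∧ n % 3 = 1) := by
  rw [ContainsOneTwo, ternaryExpansion_three_mul_add hd h, pair_infix_concat_iff, ContainsOneTwo]
  rcases eq_or_ne n 0 with rfl | hn
  · simp [ternaryExpansion]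
  · simp [getLast?_ternaryExpansion hn]

/-- For n = 0 the prepended 0 supplies the predecessor, in agreement with 0 % 3 = 0. -/
theorem containsZeroTwo_three_mul_add {n d : ℕ} (hd : d < 3) (h : d ≠ 0 ∨ n ≠ 0) :
    ContainsZeroTwo (3 * n + d) ↔ ContainsZeroTwo n ∨ (d = 2 ∧ n % 3 = 0) := by
  rw [ContainsZeroTwo, ternaryExpansion_three_mul_add hd h, ← List.cons_append,
    pair_infix_concat_iff, ContainsZeroTwo]
  rcases eq_or_ne n 0 with rfl | hn
  · simp [ternaryExpansion]
  · simp [List.getLast?_cons, getLast?_ternaryExpansion hn]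

/-! ### The classification -/

theorem ternary_induction {P : ℕ → Prop} (zero : P 0)
    (step : ∀ n d, d < 3 → (d ≠ 0 ∨ n ≠ 0) → P n → P (3 * n + d)) (n : ℕ) : P n := by
  induction n using Nat.strong_induction_on with
  | _ n ih =>
    rcases eq_or_ne n 0 with rfl | hn
    · exact zero
    · have := step (n / 3) (n % 3) (Nat.mod_lt _ (by norm_num)) (by omega) (ih _ (by omega))
      rwa [Nat.div_add_mod] at this

theorem not_containsOneTwo_of_digitCount_two_eq_zero (n : ℕ) :
    digitCount 2 n = 0 → ¬ ContainsOneTwo n ∧ ¬ ContainsZeroTwo n := by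
  intro h
  have h2 : 2 ∉ ternaryExpansion n := List.count_eq_zero.mp h
  refine ⟨fun hc => h2 (hc.subset (by simp)), fun hc => ?_⟩
  have := hc.subset (show 2 ∈ [0, 2] by simp)
  simp_all

theorem digitCount_two_pos_of_mod_three {n : ℕ} (h : n % 3 = 2) : 0 < digitCount 2 n := by
  have hl := List.mem_of_getLast? (getLast?_ternaryExpansion (n := n) (by omega))
  rw [h] at hl
  exact List.count_pos_iff.mpr hl

theorem containsZeroTwo_iff_of_digitCount_two_eq_one (n : ℕ) :
    digitCount 2 n = 1 → (ContainsZeroTwo n ↔ ¬ ContainsOneTwo n) := by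
  induction n using ternary_induction with
  | zero => simp [digitCount, ternaryExpansion]
  | step n d hd h ih =>
    rw [digitCount_three_mul_add 2 hd h, containsZeroTwo_three_mul_add hd h,
      containsOneTwo_three_mul_add hd h]
    by_cases h2 : d = 2
    · subst h2
      intro hc
      have h0 : digitCount 2 n = 0 := by simpa using hc
      obtain ⟨h1, h1'⟩ := not_containsOneTwo_of_digitCount_two_eq_zero n h0
      have hlast : n % 3 ≠ 2 := fun hm => (digitCount_two_pos_of_mod_three hm).ne' h0
      simp only [h1, h1', true_and, false_or]
      omega
    · simpa [h2] using ih

theorem three_mul_centralBinom_of_mod_three {n : ℕ} (h : n % 3 = 2) :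
    (3 : ZMod 9) * n.centralBinom = 0 := by
  have hc := centralBinom_three_mul_add_two (n / 3)
  rw [show 3 * (n / 3) + 2 = n by omega] at hc
  have h9 : ∀ x y : ZMod 9, 3 * (6 * (2 * x + 1) * y) = 0 := by decide
  rw [hc, h9]

theorem three_mul_cast_zmod_nine (n : ℕ) : (3 * n : ZMod 9) = 3 * (n % 3 : ℕ) := by
  have h : ∀ x y : ZMod 9, 3 * (3 * x + y) = 3 * y := by decide
  conv_lhs => rw [← Nat.div_add_mod n 3]
  push_cast
  rw [h]

theorem centralBinom_zmod_nine (n : ℕ) :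
    (digitCount 2 n = 0 →
      (n.centralBinom : ZMod 9) = (-1) ^ digitCount 1 n * 7 ^ oneStringCount n) ∧
    (digitCount 2 n = 1 → ¬ ContainsOneTwo n →
      (n.centralBinom : ZMod 9) = 6 * (-1) ^ digitCount 1 n) ∧
    (2 ≤ digitCount 2 n ∨ ContainsOneTwo n → (n.centralBinom : ZMod 9) = 0) := by
  induction n using ternary_induction with
  | zero =>
    simp [digitCount, ternaryExpansion, oneStringCount, card_maximalStrings, stringStarts,
      ContainsOneTwo]
  | step n d hd h ih =>
    obtain ⟨ihA, ihB, ihC⟩ := ih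
    have hpos := digitCount_two_pos_of_mod_three (n := n)
    have hthree := three_mul_centralBinom_of_mod_three (n := n)
    have hcast := three_mul_cast_zmod_nine n
    have hlt : n % 3 < 3 := Nat.mod_lt _ (by norm_num)
    simp only [digitCount_three_mul_add _ hd h, oneStringCount_three_mul_add hd h,
      containsOneTwo_three_mul_add hd h]
    interval_cases d
    · simpa [centralBinom_three_mul] using ⟨ihA, ihB, ihC⟩
    · rw [centralBinom_three_mul_add_one, hcast]
      refine ⟨fun h2 => ?_, fun h2 h12 => ?_, fun h2 => ?_⟩
      · have h2' : digitCount 2 n = 0 := by simpa using h2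
        rw [ihA h2']
        -- 2 = -1 * 7 opens a block of 1's; 8 = -1 extends one.
        have h9 : ∀ x y : ZMod 9, 2 * (x * y) = x * -1 * (y * 7) ∧ 8 * (x * y) = x * -1 * y := by
          decide
        obtain he | he | he : n % 3 = 0 ∨ n % 3 = 1 ∨ n % 3 = 2 := by omega
        · simpa [he, pow_succ] using (h9 _ _).1
        · rw [he]
          simpa [pow_succ, show (2 * (1 + 3) : ZMod 9) = 8 by decide] using (h9 _ _).2
        · exact absurd (hpos he) (by omega)
      · rw [ihB (by simpa using h2) (by simpa using h12)]
        have h9 : ∀ x y : ZMod 9, 2 * (1 + 3 * y) * (6 * x) = 6 * (x * -1) := by decide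
        simpa [pow_succ] using h9 _ _
      · rw [ihC (by simpa using h2), mul_zero]
    · rw [centralBinom_three_mul_add_two]
      have h9 : ∀ x y z : ZMod 9, 3 * x = 3 * y →
          6 * (2 * x + 1) * z = 6 * (2 * y + 1) * z := by decide +kernel
      rw [h9 _ _ _ hcast]
      refine ⟨fun h2 => absurd h2 (by simp), fun h2 h12 => ?_, fun h2 => ?_⟩
      · have h2' : digitCount 2 n = 0 := by simpa using h2
        have he : n % 3 = 0 := by
          have h1 : n % 3 ≠ 1 := fun h1 => h12 (Or.inr ⟨rfl, h1⟩)
          have h2 : n % 3 ≠ 2 := fun h1 => absurd (hpos h1) (by omega)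
          omega
        -- Since 7 ≡ 1 modulo 3, the block count no longer matters after a factor 6.
        have h7 : ∀ k : ℕ, (6 : ZMod 9) * 7 ^ k = 6 := by
          intro k
          induction k with
          | zero => rfl
          | succ k ih => rw [pow_succ, ← mul_assoc, ih]; decide
        rw [he, ihA h2', mul_comm ((-1 : ZMod 9) ^ _), ← mul_assoc]
        simp [h7]
      -- The factor is 6, 18 or 30 after a digit 0, 1 or 2. The first meets an earlier factor 6 or
      -- 0, the second vanishes, and the third meets a c(n) killed by 3.
      · obtain he | he | he : n % 3 = 0 ∨ n % 3 = 1 ∨ n % 3 = 2 := by omega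
        · have h2' : 1 ≤ digitCount 2 n ∨ ContainsOneTwo n := by simpa [he] using h2
          by_cases hC : 2 ≤ digitCount 2 n ∨ ContainsOneTwo n
          · rw [ihC hC, mul_zero]
          · rw [not_or] at hC
            rw [ihB (by have := h2'.resolve_right hC.2; omega) hC.2, he]
            generalize ((-1) ^ digitCount 1 n : ZMod 9) = x
            revert x
            decide
        · rw [he]
          generalize (n.centralBinom : ZMod 9) = x
          revert x
          decide
        · have h3 := hthree he
          rw [he]
          revert h3
          generalize (n.centralBinom : ZMod 9) = x
          revert x
          decide

theorem seven_pow_zmod_nine (k : ℕ) : (7 : ZMod 9) ^ k = 7 ^ (k % 3) := by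
  have h : (7 : ZMod 9) ^ 3 = 1 := by decide
  conv_lhs => rw [← Nat.div_add_mod k 3, pow_add, pow_mul, h, one_pow, one_mul]

/-- The residue modulo `9` of the central binomial coefficient, in terms of the digits. -/
theorem centralBinom_mod_nine_cases (n : ℕ) :
    (digitCount 2 n = 0 ∧ ¬ ContainsZeroTwo n ∧ ¬ ContainsOneTwo n ∧
      (n.centralBinom : ZMod 9) = (-1) ^ digitCount 1 n * 7 ^ (oneStringCount n % 3)) ∨
    (digitCount 2 n = 1 ∧ ContainsZeroTwo n ∧ ¬ ContainsOneTwo n ∧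
      (n.centralBinom : ZMod 9) = 6 * (-1) ^ digitCount 1 n) ∨
    ((2 ≤ digitCount 2 n ∨ ContainsOneTwo n) ∧ digitCount 2 n ≠ 0 ∧
      ¬ (ContainsZeroTwo n ∧ digitCount 2 n = 1) ∧ (n.centralBinom : ZMod 9) = 0) := by
  obtain ⟨hA, hB, hC⟩ := centralBinom_zmod_nine n
  rw [seven_pow_zmod_nine] at hA
  have h0 := not_containsOneTwo_of_digitCount_two_eq_zero n
  have h1 := containsZeroTwo_iff_of_digitCount_two_eq_one n
  obtain h | h | h : digitCount 2 n = 0 ∨ digitCount 2 n = 1 ∨ 2 ≤ digitCount 2 n := by omega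
  · exact Or.inl ⟨h, (h0 h).2, (h0 h).1, hA h⟩
  · by_cases h12 : ContainsOneTwo n
    · exact Or.inr (Or.inr ⟨Or.inr h12, by omega, fun hc => (h1 h).mp hc.1 h12,
        hC (Or.inr h12)⟩)
    · exact Or.inr (Or.inl ⟨h, (h1 h).mpr h12, h12, hB h h12⟩)
  · exact Or.inr (Or.inr ⟨Or.inl h, by omega, fun hc => by omega, hC (Or.inl h)⟩)

theorem mainTheorem9 :
    (∀ r : ℕ, 0 < r → r ≡ 2 [MOD 6] → ∀ n : ℕ,
      (aperyNumber n r 0 ≡ 1 [MOD 9] ↔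
        digitCount 2 n = 0 ∧ Even (digitCount 1 n) ∧ oneStringCount n ≡ 0 [MOD 3]) ∧
      (aperyNumber n r 0 ≡ 2 [MOD 9] ↔
        digitCount 2 n = 0 ∧ Odd (digitCount 1 n) ∧ oneStringCount n ≡ 1 [MOD 3]) ∧
      (aperyNumber n r 0 ≡ 3 [MOD 9] ↔
        ContainsZeroTwo n ∧ digitCount 2 n = 1 ∧ Odd (digitCount 1 n)) ∧
      (aperyNumber n r 0 ≡ 4 [MOD 9] ↔
        digitCount 2 n = 0 ∧ Even (digitCount 1 n) ∧ oneStringCount n ≡ 2 [MOD 3]) ∧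
      (aperyNumber n r 0 ≡ 5 [MOD 9] ↔
        digitCount 2 n = 0 ∧ Odd (digitCount 1 n) ∧ oneStringCount n ≡ 2 [MOD 3]) ∧
      (aperyNumber n r 0 ≡ 6 [MOD 9] ↔
        ContainsZeroTwo n ∧ digitCount 2 n = 1 ∧ Even (digitCount 1 n)) ∧
      (aperyNumber n r 0 ≡ 7 [MOD 9] ↔
        digitCount 2 n = 0 ∧ Even (digitCount 1 n) ∧ oneStringCount n ≡ 1 [MOD 3]) ∧
      (aperyNumber n r 0 ≡ 8 [MOD 9] ↔
        digitCount 2 n = 0 ∧ Odd (digitCount 1 n) ∧ oneStringCount n ≡ 0 [MOD 3]) ∧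
      (aperyNumber n r 0 ≡ 0 [MOD 9] ↔
        2 ≤ digitCount 2 n ∨ ContainsOneTwo n)) ∧
    (∀ n : ℕ, aperyNumber n 2 0 = (2 * n).choose n) := by
  refine ⟨fun r h0 hr n => ?_, aperyNumber_two_zero⟩
  simp only [← ZMod.natCast_eq_natCast_iff (c := 9), aperyNumber_cast_zmod_nine h0 hr]
  obtain ⟨h2, h02, h12, hc⟩ | ⟨h2, h02, h12, hc⟩ | ⟨h2, h0, h1, hc⟩ :=
    centralBinom_mod_nine_cases n
  · obtain hm | hm | hm : oneStringCount n % 3 = 0 ∨ oneStringCount n % 3 = 1 ∨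
        oneStringCount n % 3 = 2 := by omega
    all_goals
      rcases Nat.even_or_odd (digitCount 1 n) with hp | hp
      · have hp' := Nat.not_odd_iff_even.mpr hp
        simp [hc, hm, h2, h02, h12, hp, hp', hp.neg_one_pow, Nat.ModEq]
        decide
      · have hp' := Nat.not_even_iff_odd.mpr hp
        simp [hc, hm, h2, h02, h12, hp, hp', hp.neg_one_pow, Nat.ModEq]
        decide
  · rcases Nat.even_or_odd (digitCount 1 n) with hp | hp
    · have hp' := Nat.not_odd_iff_even.mpr hp
      simp [hc, h2, h02, h12, hp, hp', hp.neg_one_pow]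
      decide
    · have hp' := Nat.not_even_iff_odd.mpr hp
      simp [hc, h2, h02, h12, hp, hp', hp.neg_one_pow]
      decide
  · have h1' : ∀ p : Prop, ¬ (ContainsZeroTwo n ∧ digitCount 2 n = 1 ∧ p) :=
      fun p hp => h1 ⟨hp.1, hp.2.1⟩
    simp only [hc, h2, h0, h1', false_and]
    decide
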